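/- For points of $\{0,1\}^d$ let $D$ be the Hamming distance, let $D(q,S)=\min_{p\in S}D(q,p)$, and let $B(\rho,d)$ be the number of points of $\{0,1\}^d$ at Hamming distance at most $\rho$ from a fixed point. Logarithms are to base 2. Let $r\ge 0$ and $c\ge 1$ be real. A randomized filter (with random choices that may be shared by the construction and the query algorithm) stores a bit string for each set $S\subseteq\{0,1\}^d$ of $n$ points and answers a query $q\in\{0,1\}^d$ by 'Yes' or 'No' from the stored string and the random choices. It is an $(r,c,\varepsilon)$-distance sensitive approximate membership filter with point-wise error $\varepsilon$ for $S$ if it always answers 'Yes' when $D(q,S)\le r$, and for each $q$ with $D(q,S)>cr$ it answers 'No' with probability at least $1-\varepsilon$ over its random choices. Theorem. Consider such a filter, with point-wise error $\varepsilon$ for every set $S$ of $n$ points in $\{0,1\}^d$, and let $s$ bound the length of the stored bit string over all such $S$ and all random choices. 1. There is an absolute constant $C>0$ such that $$ s\ \ge\ C\,n\left(\frac{r^2}{d}+\log\frac1\varepsilon\right)\qquad\text{whenever}\qquad \frac{n\,B(cr,d)}{2^d}<\varepsilon<\frac14 .$$ 2. For every constant $\delta>0$ there is a constant $C_\delta>0$,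 depending only on $\delta$, such that, if $m\le d$ is a non-negative integer obtained by rounding $\delta cr$ up or down (that is, $|m-\delta cr|<1$), then $$ s\ \ge\ C_\delta\,n\left(\frac{r}{c}+\log\frac1\varepsilon\right)\qquad\text{whenever}\qquad \frac{n\,B(cr,m)}{2^{m}}<\varepsilon<\frac14 .$$ -/

import Mathlib

open MeasureTheory

/-- The Hamming cube `{0,1}^d`; its metric is Mathlib's `hammingDist`. -/
abbrev Cube (d : ℕ) : Type := Fin d → Bool

/-- The Hamming ball of (real) radius `ρ` around `q` in `{0,1}^d`. -/
noncomputable def hammingBall {d : ℕ} (q : Cube d) (ρ : ℝ) : Finset (Cube d) :=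
  Finset.univ.filter fun p => (hammingDist p q : ℝ) ≤ ρ

/-- The number `B(ρ, d)` of points of a Hamming ball of radius `ρ` in `{0,1}^d`
(it does not depend on the centre; we take the origin). -/
noncomputable def ballSize (ρ : ℝ) (d : ℕ) : ℕ :=
  (hammingBall (fun _ => false : Cube d) ρ).card

/-- `q` is near `S`: the minimum distance `D(q, S)` is at most `r`. -/
def IsNear {d : ℕ} (r : ℝ) (S : Finset (Cube d)) (q : Cube d) : Prop :=
  ∃ p ∈ S, (hammingDist q p : ℝ) ≤ r

/-- `q` is far from `S`: the minimum distance `D(q, S)` is larger than `c * r`. -/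
def IsFar {d : ℕ} (r c : ℝ) (S : Finset (Cube d)) (q : Cube d) : Prop :=
  ∀ p ∈ S, c * r < (hammingDist q p : ℝ)

/-- A randomized membership data structure on `{0,1}^d`. The outcome `ω : Ω` collects all random
choices; the construction and the query algorithm may both read it for free (shared randomness),
and apart from it the query algorithm sees only the stored bit string. Private coins are the
special case in which the two algorithms read disjoint parts of `ω`. -/
structure RandomizedFilter (d : ℕ) (Ω : Type*) where
  /-- The memory representation of a point set. -/
  encode : Ω → Finset (Cube d) → List Bool
  /-- The answer to a query, given the memory contents; `true` is 'Yes', `false` is 'No'. -/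
  answer : Ω → List Bool → Cube d → Bool

namespace RandomizedFilter

variable {d : ℕ} {Ω : Type*}

/-- What the filter built for `S` reports on the query `q`. -/
def report (F : RandomizedFilter d Ω) (S : Finset (Cube d)) (q : Cube d) (ω : Ω) : Bool :=
  F.answer ω (F.encode ω S) q

/-- `F` is, for the set `S`, an `(r, c, ε)`-distance sensitive approximate membership filter with
point-wise error `ε`: near queries are always answered 'Yes', and each far query is answered 'No'
with probability at least `1 - ε`. Nothing is required of the other queries. -/
def HasPointwiseError [MeasurableSpace Ω] (F : RandomizedFilter d Ω) (μ : Measure Ω)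
    (S : Finset (Cube d)) (r c ε : ℝ) : Prop :=
  (∀ q, IsNear r S q → ∀ ω, F.report S q ω = true) ∧
  (∀ q, IsFar r c S q →
    MeasurableSet {ω | F.report S q ω = false} ∧ 1 - ε ≤ μ.real {ω | F.report S q ω = false})

/-- On sets of `n` points, `F` uses at most `s` bits in the worst case. -/
def UsesAtMost (F : RandomizedFilter d Ω) (n s : ℕ) : Prop :=
  ∀ S : Finset (Cube d), S.card = n → ∀ ω, (F.encode ω S).length ≤ s

end RandomizedFilter

/-! Averaging fixes one outcome of the random choices for which the far false positives average at
most ε·2^d over all `n`-sets. The balls of radius cr add fewer than ε·2^d points, so by Markov at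
least a third of the sets get an answer set `Y` of density at most 3ε. Every set stored as a given
string lies in the r-interior `X` of its `Y`; if `X` has density at most M, one string serves at
most a fraction M^n of all `n`-sets, so 3·2^(s+1)·M^n ≥ 1 (`one_le_three_mul_two_pow_mul_pow`). Two
values of M give the two terms. Since `X ⊆ Y`, M = 3ε works, which gives log(1/ε). Since `Y` misses
a quarter of the cube, concentration of measure allows M = 4·exp(-r²/(2d)), which gives r²/d. The
second claim is the first one on a subcube of dimension about δcr, where r²/m is of order r/c. -/

/-! ### Concentration of measure on the cube -/

/-- Expand (Ae - a)(Ae - b) ≥ 0 and divide by Ae. With e = exp t this bounds the cross terms in the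
induction on the dimension. -/
theorem add_le_of_mul_le_sq {A e a b : ℝ} (hA : 0 < A) (he : 0 < e) (ha : a ≤ A * e)
    (hb : b ≤ A * e) (hab : a * b ≤ A ^ 2) : a + b ≤ A * (e + e⁻¹) := by
  have h : (A * e) * (a + b) ≤ (A * e) * (A * (e + e⁻¹)) := by
    have h2 : (A * e) * (A * (e + e⁻¹)) = A ^ 2 * e ^ 2 + A ^ 2 := by field_simp
    rw [h2]
    nlinarith [mul_nonneg (sub_nonneg.2 ha) (sub_nonneg.2 hb)]
  exact le_of_mul_le_mul_left h (by positivity)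

theorem Cube.sum_succ {d : ℕ} (f : Cube (d + 1) → ℝ) :
    ∑ x, f x = (∑ x : Cube d, f (Fin.cons true x)) + ∑ x : Cube d, f (Fin.cons false x) := by
  rw [← (Fin.consEquiv (fun _ : Fin (d + 1) => Bool)).sum_comp, Fintype.sum_prod_type,
    Fintype.sum_bool]
  rfl

theorem hammingDist_cons {d : ℕ} (a b : Bool) (x y : Cube d) :
    hammingDist (Fin.cons a x : Cube (d + 1)) (Fin.cons b y) =
      (if a ≠ b then 1 else 0) + hammingDist x y := by
  simp only [hammingDist, Finset.card_filter, Fin.sum_univ_succ, Fin.cons_zero, Fin.cons_succ]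

/-- A two-function form of concentration of measure on the Hamming cube. -/
theorem sum_mul_sum_le_of_mul_le_exp_hammingDist (t : ℝ) :
    ∀ (d : ℕ) (K : ℝ) (f g : Cube d → ℝ), 0 < K → (∀ x, 0 ≤ f x) → (∀ x, 0 ≤ g x) →
      (∀ x y, f x * g y ≤ K * Real.exp (t * hammingDist x y)) →
      (∑ x, f x) * (∑ y, g y) ≤ K * (4 * Real.exp (t ^ 2 / 2)) ^ d := by
  intro d
  induction d with
  | zero =>
    intro K f g _ _ _ h
    rw [Fintype.sum_unique, Fintype.sum_unique]
    refine (h _ _).trans_eq ?_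
    rw [hammingDist_self]
    simp
  | succ d ih =>
    intro K f g hK hf hg h
    have same (a : Bool) : (∑ x : Cube d, f (Fin.cons a x)) * (∑ y : Cube d, g (Fin.cons a y)) ≤
        K * (4 * Real.exp (t ^ 2 / 2)) ^ d := by
      refine ih K _ _ hK (fun _ => hf _) (fun _ => hg _) fun x y => ?_
      simpa [hammingDist_cons] using h (Fin.cons a x) (Fin.cons a y)
    have diff (a b : Bool) (hab : a ≠ b) :
        (∑ x : Cube d, f (Fin.cons a x)) * (∑ y : Cube d, g (Fin.cons b y)) ≤
        K * (4 * Real.exp (t ^ 2 / 2)) ^ d * Real.exp t := by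
      have := ih (K * Real.exp t) (fun x => f (Fin.cons a x)) (fun y => g (Fin.cons b y))
        (by positivity) (fun _ => hf _) (fun _ => hg _) fun x y => by
          have := h (Fin.cons a x) (Fin.cons b y)
          rw [hammingDist_cons, if_pos hab] at this
          rw [mul_assoc, ← Real.exp_add]
          refine this.trans_eq ?_
          push_cast
          ring_nf
      linarith
    rw [Cube.sum_succ, Cube.sum_succ]
    have htt := same true
    have hff := same false
    have htf := diff true false (by simp)
    have hft := diff false true (by simp)
    have hF (a : Bool) : 0 ≤ ∑ x : Cube d, f (Fin.cons a x) := Finset.sum_nonneg fun _ _ => hf _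
    have hG (a : Bool) : 0 ≤ ∑ x : Cube d, g (Fin.cons a x) := Finset.sum_nonneg fun _ _ => hg _
    have hF1 := hF true
    have hF0 := hF false
    have hG1 := hG true
    have hG0 := hG false
    clear hF hG same diff
    set A := K * (4 * Real.exp (t ^ 2 / 2)) ^ d with hA
    have hApos : 0 < A := by positivity
    generalize (∑ x : Cube d, f (Fin.cons true x)) = F1 at *
    generalize (∑ x : Cube d, f (Fin.cons false x)) = F0 at *
    generalize (∑ x : Cube d, g (Fin.cons true x)) = G1 at *
    generalize (∑ x : Cube d, g (Fin.cons false x)) = G0 at *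
    -- The product of the cross terms is also the product of the diagonal ones, hence at most A².
    -- This yields 2A·cosh t instead of 2A·exp t, and cosh t ≤ exp(t²/2) keeps the exponent
    -- quadratic.
    have hcross : F1 * G0 + F0 * G1 ≤ A * (Real.exp t + (Real.exp t)⁻¹) := by
      refine add_le_of_mul_le_sq hApos (Real.exp_pos t) htf hft ?_
      calc F1 * G0 * (F0 * G1) = (F1 * G1) * (F0 * G0) := by ring
        _ ≤ A * A := mul_le_mul htt hff (mul_nonneg hF0 hG0) hApos.le
        _ = A ^ 2 := by ring
    have hcosh := Real.cosh_le_exp_half_sq t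
    rw [Real.cosh_eq, Real.exp_neg] at hcosh
    have hone : 1 ≤ Real.exp (t ^ 2 / 2) := Real.one_le_exp (by positivity)
    have hpow : K * (4 * Real.exp (t ^ 2 / 2)) ^ (d + 1) = A * (4 * Real.exp (t ^ 2 / 2)) := by
      rw [hA]; ring
    rw [hpow]
    have h1 := mul_le_mul_of_nonneg_left hcosh hApos.le
    have h2 := mul_le_mul_of_nonneg_left hone hApos.le
    linarith

/-- The `r`-interior of a set that misses a quarter of the cube is exponentially small. -/
theorem card_le_of_hammingDist_le_mem {d : ℕ} {r : ℝ} (hr : 0 ≤ r) (X Y : Finset (Cube d))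
    (hXY : ∀ p ∈ X, ∀ q, (hammingDist q p : ℝ) ≤ r → q ∈ Y)
    (hY : (Y.card : ℝ) ≤ 3 / 4 * 2 ^ d) :
    (X.card : ℝ) ≤ 4 * Real.exp (-(r ^ 2 / (2 * d))) * 2 ^ d := by
  classical
  -- This `t` minimises -tr + d·t²/2; for `d = 0` division by zero makes it 0.
  set t : ℝ := r / d with ht
  have ht0 : 0 ≤ t := by positivity
  have key := sum_mul_sum_le_of_mul_le_exp_hammingDist t d (Real.exp (-(t * r)))
    (fun x => if x ∈ X then 1 else 0) (fun y => if y ∈ Yᶜ then 1 else 0) (Real.exp_pos _)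
    (fun x => by positivity) (fun x => by positivity) (by
      intro x y
      by_cases hx : x ∈ X
      · by_cases hy : y ∈ Y
        · simp only [Finset.mem_compl, hy, not_true, if_false, mul_zero]
          positivity
        · have hlt : r < hammingDist x y := by
            by_contra hle
            rw [hammingDist_comm] at hle
            exact hy (hXY x hx y (not_lt.1 hle))
          simp only [hx, Finset.mem_compl, hy, not_false_eq_true, if_true, mul_one]
          rw [← Real.exp_add]
          refine Real.one_le_exp ?_
          nlinarith
      · simp only [hx, if_false, zero_mul]
        positivity)
  simp only [Finset.sum_ite_mem, Finset.univ_inter, Finset.sum_const, nsmul_eq_mul, mul_one]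
    at key
  have hcompl : (1 / 4 : ℝ) * 2 ^ d ≤ (Yᶜ.card : ℝ) := by
    have h : ((Y.card + Yᶜ.card : ℕ) : ℝ) = 2 ^ d := by
      rw [Finset.card_add_card_compl]
      simp
    push_cast at h
    linarith
  have hexp : Real.exp (-(t * r)) * (4 * Real.exp (t ^ 2 / 2)) ^ d =
      Real.exp (-(r ^ 2 / (2 * d))) * 2 ^ d * 2 ^ d := by
    rw [mul_pow, ← Real.exp_nat_mul, mul_left_comm, ← Real.exp_add, mul_assoc, ← mul_pow]
    have : -(t * r) + d * (t ^ 2 / 2) = -(r ^ 2 / (2 * d)) := by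
      rcases Nat.eq_zero_or_pos d with h | h
      · simp [ht, h]
      · rw [ht]
        field_simp
        ring
    rw [this]
    norm_num
    ring
  rw [hexp] at key
  have hpos : (0 : ℝ) < 2 ^ d := by positivity
  have h3 : (X.card : ℝ) * (1 / 4 * 2 ^ d) ≤ Real.exp (-(r ^ 2 / (2 * d))) * 2 ^ d * 2 ^ d :=
    (mul_le_mul_of_nonneg_left hcompl (Nat.cast_nonneg _)).trans key
  have h4 : (X.card : ℝ) * (1 / 4) ≤ Real.exp (-(r ^ 2 / (2 * d))) * 2 ^ d :=
    le_of_mul_le_mul_right (by linarith) hpos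
  linarith

/-! ### Counting sets and strings -/

theorem Nat.descFactorial_mul_pow_le {k N : ℕ} (h : k ≤ N) (n : ℕ) :
    k.descFactorial n * N ^ n ≤ N.descFactorial n * k ^ n := by
  induction n with
  | zero => simp
  | succ n ih =>
    rw [Nat.descFactorial_succ, Nat.descFactorial_succ, pow_succ, pow_succ]
    have h1 : (k - n) * N ≤ (N - n) * k := by
      rw [Nat.sub_mul, Nat.sub_mul, Nat.mul_comm k N]
      exact Nat.sub_le_sub_left (Nat.mul_le_mul_left n h) _
    calc (k - n) * k.descFactorial n * (N ^ n * N)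
        = ((k - n) * N) * (k.descFactorial n * N ^ n) := by ring
      _ ≤ ((N - n) * k) * (N.descFactorial n * k ^ n) := Nat.mul_le_mul h1 ih
      _ = _ := by ring

/-- A random `n`-subset of `N` points falls inside a fixed `k`-subset with probability at most
(k/N)^n, because (k-i)/(N-i) ≤ k/N for each successive draw. -/
theorem Nat.choose_mul_pow_le {k N : ℕ} (h : k ≤ N) (n : ℕ) :
    k.choose n * N ^ n ≤ N.choose n * k ^ n := by
  have := Nat.descFactorial_mul_pow_le h n
  rw [Nat.descFactorial_eq_factorial_mul_choose, Nat.descFactorial_eq_factorial_mul_choose,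
    mul_assoc, mul_assoc] at this
  exact Nat.le_of_mul_le_mul_left this (Nat.factorial_pos n)

theorem card_le_two_pow_of_length_le (T : Finset (List Bool)) (s : ℕ)
    (hT : ∀ w ∈ T, w.length ≤ s) : T.card ≤ 2 ^ (s + 1) := by
  classical
  have hsub : T ⊆ (Finset.range (s + 1)).biUnion fun i =>
      (Finset.univ : Finset (List.Vector Bool i)).image List.Vector.toList := by
    intro w hw
    simp only [Finset.mem_biUnion, Finset.mem_range, Finset.mem_image, Finset.mem_univ, true_and]
    exact ⟨w.length, Nat.lt_succ_of_le (hT w hw), ⟨w, rfl⟩, rfl⟩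
  calc T.card ≤ _ := Finset.card_le_card hsub
    _ ≤ ∑ i ∈ Finset.range (s + 1), 2 ^ i := by
      refine Finset.card_biUnion_le.trans (Finset.sum_le_sum fun i _ => ?_)
      refine Finset.card_image_le.trans ?_
      simp [card_vector]
    _ ≤ 2 ^ (s + 1) := by
      rw [Nat.geomSum_eq le_rfl]
      simp

theorem card_hammingBall {d : ℕ} (q : Cube d) (ρ : ℝ) :
    (hammingBall q ρ).card = ballSize ρ d := by
  have hinv : Function.Involutive (fun (x : Cube d) i => xor (x i) (q i)) := fun x => by
    funext i; simp
  refine Finset.card_equiv hinv.toPerm fun p => ?_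
  have : hammingDist (fun i => xor (p i) (q i)) (fun _ => false) = hammingDist p q := by
    simp only [hammingDist]
    congr 1
    ext i
    simp
  simp [hammingBall, this]

/-- The counting bound: if most answer sets are small and small answer sets have small
`r`-interior, then the encoding needs many strings. -/
theorem one_le_three_mul_two_pow_mul_pow {d n s : ℕ} {r ε M : ℝ} (hε : 0 < ε) (hn : n ≤ 2 ^ d)
    (enc : Finset (Cube d) → List Bool) (ans : List Bool → Cube d → Bool)
    (hlen : ∀ S, S.card = n → (enc S).length ≤ s)
    (hnear : ∀ S, S.card = n → ∀ q, IsNear r S q → ans (enc S) q = true)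
    (hsum : ∑ S ∈ Finset.powersetCard n (Finset.univ : Finset (Cube d)),
      ((Finset.univ.filter fun q => ans (enc S) q = true).card : ℝ)
        ≤ 2 * ε * 2 ^ d * (2 ^ d).choose n)
    (hM : ∀ X Y : Finset (Cube d), (∀ p ∈ X, ∀ q, (hammingDist q p : ℝ) ≤ r → q ∈ Y) →
      (Y.card : ℝ) ≤ 3 * ε * 2 ^ d → (X.card : ℝ) ≤ M * 2 ^ d) :
    1 ≤ 3 * 2 ^ (s + 1) * M ^ n := by
  classical
  set P := Finset.powersetCard n (Finset.univ : Finset (Cube d)) with hP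
  have hPcard : P.card = (2 ^ d).choose n := by simp [hP]
  let Y : List Bool → Finset (Cube d) := fun w => Finset.univ.filter fun q => ans w q = true
  let X : List Bool → Finset (Cube d) := fun w =>
    Finset.univ.filter fun p => ∀ q, (hammingDist q p : ℝ) ≤ r → ans w q = true
  set G := P.filter fun S => ((Y (enc S)).card : ℝ) ≤ 3 * ε * 2 ^ d with hG
  have hE : (0 : ℝ) < ε * 2 ^ d := by positivity
  have hchoose : (0 : ℝ) < (2 ^ d).choose n := by
    exact_mod_cast Nat.choose_pos hn
  -- Markov with mean at most 2ε·2^d and threshold 3ε·2^d: at most two thirds of the sets are bad.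
  have hGcard : ((2 ^ d).choose n : ℝ) ≤ 3 * G.card := by
    have hbad : ((P.filter fun S => ¬ ((Y (enc S)).card : ℝ) ≤ 3 * ε * 2 ^ d).card : ℝ)
        * (3 * ε * 2 ^ d) ≤ 2 * ε * 2 ^ d * (2 ^ d).choose n := by
      refine le_trans ?_ hsum
      rw [← nsmul_eq_mul]
      refine (Finset.card_nsmul_le_sum _ (fun S => ((Y (enc S)).card : ℝ)) _
        fun S hS => (not_le.1 (Finset.mem_filter.1 hS).2).le).trans ?_
      exact Finset.sum_le_sum_of_subset_of_nonneg (Finset.filter_subset _ _)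
        fun _ _ _ => Nat.cast_nonneg _
    have hsplit := Finset.card_filter_add_card_filter_not (s := P)
      fun S => ((Y (enc S)).card : ℝ) ≤ 3 * ε * 2 ^ d
    rw [hPcard, ← hG] at hsplit
    have hsplit' := congrArg (Nat.cast (R := ℝ)) hsplit
    push_cast at hsplit'
    have : (P.filter fun S => ¬ ((Y (enc S)).card : ℝ) ≤ 3 * ε * 2 ^ d).card * (3 : ℝ)
        ≤ 2 * (2 ^ d).choose n := le_of_mul_le_mul_right (by linarith) hE
    linarith
  have hfiber : ∀ w ∈ G.image enc,
      ((G.filter fun S => enc S = w).card : ℝ) ≤ M ^ n * (2 ^ d).choose n := by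
    intro w hw
    obtain ⟨S, hS, rfl⟩ := Finset.mem_image.1 hw
    have hX : ((X (enc S)).card : ℝ) ≤ M * 2 ^ d :=
      hM (X (enc S)) (Y (enc S)) (fun p hp q hq => by
        simp only [X, Y, Finset.mem_filter, Finset.mem_univ, true_and] at hp ⊢
        exact hp q hq) (Finset.mem_filter.1 hS).2
    have hsub : (G.filter fun S' => enc S' = enc S) ⊆ Finset.powersetCard n (X (enc S)) := by
      intro S' hS'
      obtain ⟨hS'G, heq⟩ := Finset.mem_filter.1 hS'
      have hcard : S'.card = n := (Finset.mem_powersetCard.1 (Finset.mem_filter.1 hS'G).1).2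
      refine Finset.mem_powersetCard.2 ⟨fun p hp => ?_, hcard⟩
      simp only [X, Finset.mem_filter, Finset.mem_univ, true_and]
      intro q hq
      rw [← heq]
      exact hnear S' hcard q ⟨p, hp, hq⟩
    have hle : (X (enc S)).card ≤ 2 ^ d := by
      simpa using Finset.card_le_univ (X (enc S))
    have hch : ((X (enc S)).card.choose n : ℝ) * ((2 : ℝ) ^ d) ^ n ≤
        (2 ^ d).choose n * ((X (enc S)).card : ℝ) ^ n := by
      exact_mod_cast Nat.choose_mul_pow_le hle n
    have hpow : ((X (enc S)).card : ℝ) ^ n ≤ M ^ n * ((2 : ℝ) ^ d) ^ n := by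
      rw [← mul_pow]
      exact pow_le_pow_left₀ (Nat.cast_nonneg _) hX n
    have hfin : ((X (enc S)).card.choose n : ℝ) ≤ M ^ n * (2 ^ d).choose n := by
      refine le_of_mul_le_mul_right (hch.trans ?_) (by positivity : (0 : ℝ) < ((2 : ℝ) ^ d) ^ n)
      calc _ ≤ ((2 ^ d).choose n : ℝ) * (M ^ n * ((2 : ℝ) ^ d) ^ n) :=
            mul_le_mul_of_nonneg_left hpow hchoose.le
        _ = _ := by ring
    refine le_trans ?_ hfin
    exact_mod_cast (Finset.card_le_card hsub).trans_eq (Finset.card_powersetCard _ _)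
  have hcount : (G.card : ℝ) ≤ (G.image enc).card * (M ^ n * (2 ^ d).choose n) := by
    rw [Finset.card_eq_sum_card_image enc G]
    push_cast
    rw [← nsmul_eq_mul]
    exact Finset.sum_le_card_nsmul _ _ _ hfiber
  have himage : ((G.image enc).card : ℝ) ≤ 2 ^ (s + 1) := by
    exact_mod_cast card_le_two_pow_of_length_le _ s fun w hw => by
      obtain ⟨S, hS, rfl⟩ := Finset.mem_image.1 hw
      exact hlen S (Finset.mem_powersetCard.1 (Finset.mem_filter.1 hS).1).2
  have hMn : 0 ≤ M ^ n * (2 ^ d).choose n := by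
    have : 0 ≤ M := by
      have := (Nat.cast_nonneg _).trans (hM ∅ ∅ (by simp) (by simpa using by positivity))
      exact nonneg_of_mul_nonneg_left this (by positivity)
    positivity
  have hall : ((2 ^ d).choose n : ℝ) * 1 ≤ (2 ^ d).choose n * (3 * 2 ^ (s + 1) * M ^ n) := by
    have := mul_le_mul_of_nonneg_right himage hMn
    linarith
  exact le_of_mul_le_mul_left hall hchoose

/-! ### From filters to the space bound -/

namespace RandomizedFilter

variable {d n s : ℕ} {Ω : Type*} [MeasurableSpace Ω] {μ : Measure Ω} [IsProbabilityMeasure μ]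
  {r c ε : ℝ} {F : RandomizedFilter d Ω}

open Classical in
/-- Some outcome of the random choices is at least as good as the average one: for it, the far
queries answered 'Yes' number at most `ε 2 ^ d` per point set, on average over the sets. -/
theorem exists_sum_card_far_le (hε : 0 ≤ ε)
    (hF : ∀ S : Finset (Cube d), S.card = n → F.HasPointwiseError μ S r c ε) :
    ∃ ω, ∑ S ∈ Finset.powersetCard n (Finset.univ : Finset (Cube d)),
      ((Finset.univ.filter fun q => IsFar r c S q ∧ F.report S q ω = true).card : ℝ)
        ≤ ε * 2 ^ d * (2 ^ d).choose n := by
  set P := Finset.powersetCard n (Finset.univ : Finset (Cube d)) with hP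
  -- The event is empty for queries that are not far, where neither measurability nor an error bound
  -- is available.
  let A : Finset (Cube d) → Cube d → Set Ω := fun S q =>
    if IsFar r c S q then {ω | F.report S q ω = false}ᶜ else ∅
  have hA : ∀ S ∈ P, ∀ q, MeasurableSet (A S q) ∧ μ.real (A S q) ≤ ε := by
    intro S hS q
    by_cases hq : IsFar r c S q
    · obtain ⟨hm, hle⟩ := (hF S (Finset.mem_powersetCard.1 hS).2).2 q hq
      simp only [A, if_pos hq]
      refine ⟨hm.compl, ?_⟩
      rw [probReal_compl_eq_one_sub hm]
      linarith
    · simp [A, hq, hε]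
  have hint : ∀ S ∈ P, ∀ q, Integrable ((A S q).indicator fun _ => (1 : ℝ)) μ := fun S hS q =>
    (integrable_const _).indicator (hA S hS q).1
  obtain ⟨ω, hω⟩ := exists_le_integral (μ := μ)
    (f := fun ω => ∑ S ∈ P, ∑ q, (A S q).indicator (fun _ => (1 : ℝ)) ω)
    (integrable_finsetSum _ fun S hS => integrable_finsetSum _ fun q _ => hint S hS q)
  refine ⟨ω, ?_⟩
  have hleft : ∑ S ∈ P, ∑ q, (A S q).indicator (fun _ => (1 : ℝ)) ω = ∑ S ∈ P,
      ((Finset.univ.filter fun q => IsFar r c S q ∧ F.report S q ω = true).card : ℝ) := by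
    refine Finset.sum_congr rfl fun S _ => ?_
    rw [Finset.card_filter]
    push_cast
    refine Finset.sum_congr rfl fun q _ => ?_
    by_cases hq : IsFar r c S q <;> simp [A, hq, Set.indicator_apply]
  rw [← hleft]
  refine hω.trans ?_
  rw [integral_finsetSum _ fun S hS => integrable_finsetSum _ fun q _ => hint S hS q]
  have hcard : (P.card : ℝ) = (2 ^ d).choose n := by simp [hP]
  calc _ ≤ ∑ S ∈ P, ε * 2 ^ d := by
        refine Finset.sum_le_sum fun S hS => ?_
        rw [integral_finsetSum _ fun q _ => hint S hS q]
        calc _ ≤ ∑ q : Cube d, ε := Finset.sum_le_sum fun q _ => by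
              rw [integral_indicator_const _ (hA S hS q).1]
              simpa using (hA S hS q).2
          _ = ε * 2 ^ d := by simp [mul_comm]
    _ = _ := by rw [Finset.sum_const, nsmul_eq_mul, hcard, mul_comm]

open Classical in
theorem card_report_le {Ω : Type*} {F : RandomizedFilter d Ω} (S : Finset (Cube d)) (ω : Ω) :
    (Finset.univ.filter fun q => F.report S q ω = true).card ≤ S.card * ballSize (c * r) d +
      (Finset.univ.filter fun q => IsFar r c S q ∧ F.report S q ω = true).card := by
  have hsub : (Finset.univ.filter fun q => F.report S q ω = true) ⊆
      (S.biUnion fun p => hammingBall p (c * r)) ∪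
        (Finset.univ.filter fun q => IsFar r c S q ∧ F.report S q ω = true) := by
    intro q hq
    by_cases hfar : IsFar r c S q
    · exact Finset.mem_union_right _ (by simpa [hfar] using hq)
    · refine Finset.mem_union_left _ ?_
      simp only [IsFar, not_forall, not_lt] at hfar
      obtain ⟨p, hp, hle⟩ := hfar
      exact Finset.mem_biUnion.2 ⟨p, hp, by simpa [hammingBall] using hle⟩
  refine (Finset.card_le_card hsub).trans ((Finset.card_union_le _ _).trans ?_)
  gcongr
  refine Finset.card_biUnion_le.trans ?_
  simp [card_hammingBall]

theorem card_lt_two_pow (hr : 0 ≤ r) (hc : 1 ≤ c) (hB : (n : ℝ) * ballSize (c * r) d / 2 ^ d < ε)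
    (hε : ε < 1 / 4) : (n : ℝ) < 2 ^ d := by
  rw [div_lt_iff₀ (by positivity)] at hB
  have hone : 1 ≤ ballSize (c * r) d := by
    refine Finset.card_pos.2 ⟨fun _ => false, ?_⟩
    simp only [hammingBall, Finset.mem_filter, Finset.mem_univ, true_and, hammingDist_self]
    push_cast
    positivity
  have hone' : (1 : ℝ) ≤ ballSize (c * r) d := by exact_mod_cast hone
  have hn : (0 : ℝ) ≤ n := Nat.cast_nonneg n
  have hd : (0 : ℝ) < 2 ^ d := by positivity
  nlinarith

theorem error_pos (hB : (n : ℝ) * ballSize (c * r) d / 2 ^ d < ε) : 0 < ε :=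
  lt_of_le_of_lt (by positivity) hB

/-- With no stored bits the answers do not depend on the set; every point lies in some `n`-set, so
all answers are 'Yes'. But the `n` balls cannot cover the cube, so some query is far. The bound
absorbs the additive constant of `logb_bound`. -/
theorem length_pos {μ : Measure Ω} (hn : 0 < n) (hr : 0 ≤ r) (hc : 1 ≤ c)
    (hF : ∀ S : Finset (Cube d), S.card = n → F.HasPointwiseError μ S r c ε)
    (hs : F.UsesAtMost n s) (hB : (n : ℝ) * ballSize (c * r) d / 2 ^ d < ε) (hε : ε < 1 / 4) :
    1 ≤ s := by
  classical
  by_contra h0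
  obtain rfl : s = 0 := by omega
  have hlt : n < 2 ^ d := by exact_mod_cast card_lt_two_pow hr hc hB hε
  have henc (S : Finset (Cube d)) (hS : S.card = n) (ω : Ω) : F.encode ω S = [] :=
    List.length_eq_zero_iff.1 (Nat.le_zero.1 (hs S hS ω))
  have hex (q : Cube d) : ∃ S : Finset (Cube d), q ∈ S ∧ S.card = n := by
    obtain ⟨S, hqS, -, hS⟩ := Finset.exists_subsuperset_card_eq
      (Finset.subset_univ {q}) (by simpa using Nat.succ_le_of_lt hn) (by simpa using hlt.le : n ≤ _)
    exact ⟨S, by simpa using hqS, hS⟩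
  obtain ⟨S, -, hS⟩ := hex fun _ => false
  have hyes (q : Cube d) (ω : Ω) : F.report S q ω = true := by
    obtain ⟨S', hq, hS'⟩ := hex q
    have := (hF S' hS').1 q ⟨q, hq, by simpa using hr⟩ ω
    rwa [report, henc S' hS', ← henc S hS ω] at this
  have hfar : ∃ q, IsFar r c S q := by
    by_contra hno
    have hcov : (Finset.univ : Finset (Cube d)) ⊆ S.biUnion fun p => hammingBall p (c * r) := by
      intro q _
      simp only [not_exists, IsFar, not_forall, not_lt] at hno
      obtain ⟨p, hp, hle⟩ := hno q
      exact Finset.mem_biUnion.2 ⟨p, hp, by simpa [hammingBall] using hle⟩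
    have hle := (Finset.card_le_card hcov).trans Finset.card_biUnion_le
    simp only [card_hammingBall, Finset.sum_const, smul_eq_mul, hS] at hle
    have hle' : (2 : ℝ) ^ d ≤ n * ballSize (c * r) d := by
      have : Fintype.card (Cube d) = 2 ^ d := by simp
      rw [Finset.card_univ, this] at hle
      exact_mod_cast hle
    rw [div_lt_iff₀ (by positivity)] at hB
    have hd : (0 : ℝ) < 2 ^ d := by positivity
    nlinarith
  obtain ⟨q, hq⟩ := hfar
  have := ((hF S hS).2 q hq).2
  simp only [hyes, Bool.true_eq_false, Set.ofPred_false, measureReal_empty] at this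
  linarith

theorem one_le_of_interior_le {M : ℝ} (hr : 0 ≤ r) (hc : 1 ≤ c)
    (hF : ∀ S : Finset (Cube d), S.card = n → F.HasPointwiseError μ S r c ε)
    (hs : F.UsesAtMost n s) (hB : (n : ℝ) * ballSize (c * r) d / 2 ^ d < ε) (hε : ε < 1 / 4)
    (hM : ∀ X Y : Finset (Cube d), (∀ p ∈ X, ∀ q, (hammingDist q p : ℝ) ≤ r → q ∈ Y) →
      (Y.card : ℝ) ≤ 3 * ε * 2 ^ d → (X.card : ℝ) ≤ M * 2 ^ d) :
    1 ≤ 3 * 2 ^ (s + 1) * M ^ n := by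
  classical
  have hε0 := error_pos hB
  obtain ⟨ω, hω⟩ := exists_sum_card_far_le hε0.le hF
  refine one_le_three_mul_two_pow_mul_pow hε0
    (by exact_mod_cast (card_lt_two_pow hr hc hB hε).le) (F.encode ω) (F.answer ω)
    (fun S hS => hs S hS ω) (fun S hS q hq => (hF S hS).1 q hq ω) ?_ hM
  set P := Finset.powersetCard n (Finset.univ : Finset (Cube d)) with hP
  have hcard : (P.card : ℝ) = (2 ^ d).choose n := by simp [hP]
  have hbound : ∀ S ∈ P,
      ((Finset.univ.filter fun q => F.answer ω (F.encode ω S) q = true).card : ℝ) ≤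
        n * ballSize (c * r) d +
        ((Finset.univ.filter fun q => IsFar r c S q ∧ F.report S q ω = true).card : ℝ) := by
    intro S hS
    have := card_report_le (F := F) (r := r) (c := c) S ω
    rw [(Finset.mem_powersetCard.1 hS).2] at this
    exact_mod_cast this
  refine (Finset.sum_le_sum hbound).trans ?_
  rw [Finset.sum_add_distrib, Finset.sum_const, nsmul_eq_mul, hcard]
  rw [div_lt_iff₀ (by positivity)] at hB
  have := mul_le_mul_of_nonneg_left hB.le (Nat.cast_nonneg ((2 ^ d).choose n) : (0 : ℝ) ≤ _)
  linarith

theorem logb_bound {M : ℝ} (hM : 0 < M) (h : 1 ≤ 3 * 2 ^ (s + 1) * M ^ n) :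
    n * Real.logb 2 M⁻¹ ≤ s + 3 := by
  have h1 : (M⁻¹) ^ n ≤ 2 ^ (s + 3) := by
    rw [inv_pow, inv_le_iff_one_le_mul₀ (by positivity)]
    refine h.trans ?_
    have : (2 : ℝ) ^ (s + 3) = 4 * 2 ^ (s + 1) := by ring
    rw [this]
    gcongr
    norm_num
  have h2 := Real.logb_le_logb_of_le (by norm_num : (1 : ℝ) < 2) (by positivity) h1
  rw [Real.logb_pow, Real.logb_pow, Real.logb_self_eq_one (by norm_num)] at h2
  simpa using h2

/-- The lower bound on the space, with the additive terms `r ^ 2 / d` and `log (1 / ε)`. -/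
theorem space_lower_bound (hr : 0 ≤ r) (hc : 1 ≤ c)
    (hF : ∀ S : Finset (Cube d), S.card = n → F.HasPointwiseError μ S r c ε)
    (hs : F.UsesAtMost n s) (hB : (n : ℝ) * ballSize (c * r) d / 2 ^ d < ε) (hε : ε < 1 / 4) :
    (n : ℝ) * (r ^ 2 / d + Real.logb 2 (1 / ε)) ≤ 68 * s := by
  rcases Nat.eq_zero_or_pos n with rfl | hn
  · simp
  have hε0 := error_pos hB
  have hs1 : (1 : ℝ) ≤ s := by exact_mod_cast length_pos hn hr hc hF hs hB hε
  have h1 := logb_bound (by positivity : 0 < 3 * ε) (one_le_of_interior_le hr hc hF hs hB hε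
    (M := 3 * ε) fun X Y hXY hY => by
      refine le_trans ?_ hY
      exact_mod_cast Finset.card_le_card fun p hp => hXY p hp p (by simpa using hr))
  have h2 := logb_bound (by positivity : 0 < 4 * Real.exp (-(r ^ 2 / (2 * d))))
    (one_le_of_interior_le hr hc hF hs hB hε
    (M := 4 * Real.exp (-(r ^ 2 / (2 * d)))) fun X Y hXY hY => by
      refine card_le_of_hammingDist_le_mem hr X Y hXY (hY.trans ?_)
      have : (0 : ℝ) < 2 ^ d := by positivity
      nlinarith)
  have hn0 : (0 : ℝ) ≤ n := Nat.cast_nonneg n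
  have hL : 2 ≤ Real.logb 2 (1 / ε) := by
    rw [Real.le_logb_iff_rpow_le (by norm_num) (by positivity), le_div_iff₀ hε0]
    norm_num
    linarith
  -- As 3^5 ≤ 2^8, passing from ε to 3ε costs at most 8/5, and L - 8/5 ≥ L/5 once L ≥ 2.
  have h3 : Real.logb 2 (1 / ε) ≤ 5 * Real.logb 2 (3 * ε)⁻¹ := by
    have h : Real.logb 2 3 ≤ 8 / 5 := by
      have h35 : Real.logb 2 ((3 : ℝ) ^ 5) ≤ Real.logb 2 ((2 : ℝ) ^ 8) :=
        Real.logb_le_logb_of_le (by norm_num) (by norm_num) (by norm_num)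
      rw [Real.logb_pow, Real.logb_pow, Real.logb_self_eq_one (by norm_num)] at h35
      push_cast at h35
      linarith
    rw [Real.logb_inv, Real.logb_mul (by norm_num) hε0.ne']
    rw [one_div, Real.logb_inv] at hL ⊢
    linarith
  have h4 : r ^ 2 / (2 * d) - 2 ≤ Real.logb 2 (4 * Real.exp (-(r ^ 2 / (2 * d))))⁻¹ := by
    have hx : 0 ≤ r ^ 2 / (2 * d) := by positivity
    have h4 : Real.logb 2 4 = 2 := by
      rw [show (4 : ℝ) = 2 ^ 2 by norm_num, Real.logb_pow, Real.logb_self_eq_one (by norm_num)]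
      norm_num
    rw [Real.logb_inv, Real.logb_mul (by norm_num) (Real.exp_ne_zero _), h4, Real.logb,
      Real.log_exp]
    have hlog2 : 0 < Real.log 2 := Real.log_pos (by norm_num)
    have hlog1 : Real.log 2 ≤ 1 := by linarith [Real.log_two_lt_d9]
    have := le_div_self hx hlog2 hlog1
    rw [neg_div]
    linarith
  -- Write L = log(1/ε). Since s + 3 ≤ 4s, nL ≤ 20s; then 2n ≤ nL ≤ 20s gives n·r²/d ≤ 2(4s + 20s) =
  -- 48s, and 20 + 48 = 68.
  have h5 := mul_le_mul_of_nonneg_left h3 hn0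
  have h6 := mul_le_mul_of_nonneg_left h4 hn0
  have h7 := mul_le_mul_of_nonneg_left hL hn0
  have h8 : r ^ 2 / d = 2 * (r ^ 2 / (2 * d)) := by
    rw [mul_comm (2 : ℝ) (d : ℝ), ← div_div]
    ring
  rw [h8]
  linarith

end RandomizedFilter

/-! ### Restriction to a subcube -/

/-- The isometric embedding of a smaller cube that pads with zeros. -/
def Cube.pad (m d : ℕ) (x : Cube m) : Cube d := fun i =>
  if h : i.val < m then x ⟨i, h⟩ else false

theorem Cube.hammingDist_pad {m d : ℕ} (h : m ≤ d) (x y : Cube m) :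
    hammingDist (Cube.pad m d x) (Cube.pad m d y) = hammingDist x y := by
  symm
  refine Finset.card_bij (fun i _ => Fin.castLE h i) ?_ ?_ ?_
  · intro i hi
    refine Finset.mem_filter.2 ⟨Finset.mem_univ _, ?_⟩
    simpa [Cube.pad] using (Finset.mem_filter.1 hi).2
  · intro i _ j _ hij
    exact Fin.castLE_injective h hij
  · intro i hi
    replace hi := (Finset.mem_filter.1 hi).2
    by_cases him : i.val < m
    · refine ⟨⟨i, him⟩, ?_, rfl⟩
      refine Finset.mem_filter.2 ⟨Finset.mem_univ _, ?_⟩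
      simpa [Cube.pad, him] using hi
    · simp [Cube.pad, him] at hi

theorem Cube.pad_injective {m d : ℕ} (h : m ≤ d) : Function.Injective (Cube.pad m d) :=
  fun x y hxy => by
    rw [← hammingDist_eq_zero, ← Cube.hammingDist_pad h, hxy, hammingDist_self]

namespace RandomizedFilter

/-- The filter on a smaller cube obtained by padding with zeros. -/
def restrict {m d : ℕ} {Ω : Type*} (F : RandomizedFilter d Ω) (h : m ≤ d) :
    RandomizedFilter m Ω where
  encode ω S := F.encode ω (S.map ⟨Cube.pad m d, Cube.pad_injective h⟩)
  answer ω w q := F.answer ω w (Cube.pad m d q)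

theorem HasPointwiseError.restrict {m d : ℕ} {Ω : Type*} [MeasurableSpace Ω] {μ : Measure Ω}
    {F : RandomizedFilter d Ω} (h : m ≤ d) {S : Finset (Cube m)} {r c ε : ℝ}
    (hF : F.HasPointwiseError μ (S.map ⟨Cube.pad m d, Cube.pad_injective h⟩) r c ε) :
    (F.restrict h).HasPointwiseError μ S r c ε := by
  refine ⟨fun q hq ω => hF.1 (Cube.pad m d q) ?_ ω, fun q hq => hF.2 (Cube.pad m d q) ?_⟩
  · obtain ⟨p, hp, hle⟩ := hq
    exact ⟨Cube.pad m d p, Finset.mem_map.2 ⟨p, hp, rfl⟩, by rwa [Cube.hammingDist_pad h]⟩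
  · intro p' hp'
    obtain ⟨p, hp, rfl⟩ := Finset.mem_map.1 hp'
    simpa [Cube.hammingDist_pad h] using hq p hp

end RandomizedFilter

/-- If δcr ≥ 1, rounding at most doubles it, so m ≤ 2δcr; otherwise r/c is itself at most 1/δ. In
the main proof the term 1/δ is absorbed by log(1/ε) ≥ 1. -/
theorem div_le_sq_div_add {δ r c m : ℝ} (hδ : 0 < δ) (hr : 0 ≤ r) (hc : 1 ≤ c) (hm0 : 0 < m)
    (hm : m < δ * c * r + 1) : r / c ≤ 2 * δ * (r ^ 2 / m) + 1 / δ := by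
  have hc0 : 0 < c := by linarith
  rcases le_total 1 (δ * c * r) with h | h
  · have h1 : r / c ≤ 2 * δ * (r ^ 2 / m) := by
      rw [mul_div_assoc', div_le_div_iff₀ hc0 hm0]
      have := mul_le_mul_of_nonneg_left (by linarith : m ≤ 2 * (δ * c * r)) hr
      linarith
    have : 0 ≤ 1 / δ := by positivity
    linarith
  · have h1 : r / c ≤ 1 / δ := by
      rw [div_le_div_iff₀ hc0 hδ]
      have : δ * r * 1 ≤ δ * r * c := mul_le_mul_of_nonneg_left hc (by positivity)
      linarith
    have : 0 ≤ 2 * δ * (r ^ 2 / m) := by positivity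
    linarith

theorem theorem3 :
    (∃ C : ℝ, 0 < C ∧
      ∀ (Ω : Type*) [MeasurableSpace Ω] (μ : Measure Ω) [IsProbabilityMeasure μ]
        (n d s : ℕ) (r c ε : ℝ) (F : RandomizedFilter d Ω),
        0 ≤ r → 1 ≤ c →
        (∀ S : Finset (Cube d), S.card = n → F.HasPointwiseError μ S r c ε) →
        F.UsesAtMost n s →
        (n : ℝ) * ballSize (c * r) d / 2 ^ d < ε → ε < 1 / 4 →
        C * (n * (r ^ 2 / d + Real.logb 2 (1 / ε))) ≤ s) ∧
    (∀ δ : ℝ, 0 < δ → ∃ C : ℝ, 0 < C ∧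
      ∀ (Ω : Type*) [MeasurableSpace Ω] (μ : Measure Ω) [IsProbabilityMeasure μ]
        (n d s m : ℕ) (r c ε : ℝ) (F : RandomizedFilter d Ω),
        0 ≤ r → 1 ≤ c →
        (∀ S : Finset (Cube d), S.card = n → F.HasPointwiseError μ S r c ε) →
        F.UsesAtMost n s →
        |(m : ℝ) - δ * c * r| < 1 → m ≤ d →
        (n : ℝ) * ballSize (c * r) m / 2 ^ m < ε → ε < 1 / 4 →
        C * (n * (r / c + Real.logb 2 (1 / ε))) ≤ s) := by
  refine ⟨⟨1 / 68, by norm_num, ?_⟩, fun δ hδ =>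
    ⟨1 / (68 * (2 * δ + 1 / δ + 1)), by positivity, ?_⟩⟩
  · intro Ω _ μ _ n d s r c ε F hr hc hF hs hB hε
    have := RandomizedFilter.space_lower_bound hr hc hF hs hB hε
    linarith
  · intro Ω _ μ _ n d s m r c ε F hr hc hF hs hm hmd hB hε
    have hbound := RandomizedFilter.space_lower_bound (F := F.restrict hmd) (s := s) hr hc
      (fun S hS => (hF _ (by simpa using hS)).restrict hmd)
      (fun S hS ω => hs _ (by simpa using hS) ω) hB hε
    have hlt := RandomizedFilter.card_lt_two_pow hr hc hB hε
    have hε0 := RandomizedFilter.error_pos hB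
    rcases Nat.eq_zero_or_pos n with rfl | hn
    · simp
    -- In dimension 0 the density condition would force n < 1.
    have hm0 : (0 : ℝ) < m := by
      rcases Nat.eq_zero_or_pos m with rfl | h
      · have : (1 : ℝ) ≤ n := by exact_mod_cast hn
        simp only [pow_zero] at hlt
        linarith
      · exact_mod_cast h
    have hL : 1 ≤ Real.logb 2 (1 / ε) := by
      rw [Real.le_logb_iff_rpow_le (by norm_num) (by positivity), le_div_iff₀ hε0]
      norm_num
      linarith
    have hrc := div_le_sq_div_add hδ hr hc hm0 (by linarith [(abs_lt.1 hm).2])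
    set L := Real.logb 2 (1 / ε)
    have hQ : 0 ≤ r ^ 2 / m := by positivity
    set Q := r ^ 2 / (m : ℝ)
    have hδ1 : 0 < 1 / δ := by positivity
    have hcomb : r / c + L ≤ (2 * δ + 1 / δ + 1) * (Q + L) := by
      nlinarith [mul_nonneg hδ.le (by linarith : 0 ≤ L), mul_nonneg hδ1.le hQ,
        mul_nonneg hδ1.le (by linarith : 0 ≤ L - 1)]
    rw [one_div, inv_mul_le_iff₀ (by positivity)]
    calc (n : ℝ) * (r / c + L) ≤ n * ((2 * δ + 1 / δ + 1) * (Q + L)) := by gcongr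
      _ = (2 * δ + 1 / δ + 1) * (n * (Q + L)) := by ring
      _ ≤ (2 * δ + 1 / δ + 1) * (68 * s) := by gcongr
      _ = _ := by ring
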